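/- Let $\Omega$ be a finite set with $|\Omega| \geqslant 3$, let $G \leqslant {\rm Sym}(\Omega)$ be a primitive permutation group, and let $N$ be the socle of $G$, that is, the subgroup of $G$ generated by the minimal normal subgroups of $G$. For a permutation group $H$ on a finite set, let $\Delta(H)$ be the set of derangements in $H$ (the elements of $H$ with no fixed points) and put $\Delta(H)^2 = \{xy : x, y \in \Delta(H)\}$. Suppose that the Larsen--Shalev--Tiep conjecture holds, that is, $T = \Delta(T)^2$ for every finite set $\Gamma$ and every transitive permutation group $T \leqslant {\rm Sym}(\Gamma)$ such that $T$ is a non-abelian simple group. Then $N = \Delta(N)^2$, where the derangements in $N$ are taken with respect to the action of $N$ on $\Omega$. -/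

import Mathlib

open scoped Pointwise

/-- `N` is a minimal normal subgroup of `G`: it is minimal, with respect to inclusion, among the
nontrivial normal subgroups of `G`. -/
def IsMinimalNormal {G : Type*} [Group G] (N : Subgroup G) : Prop :=
  Minimal (fun M : Subgroup G => M.Normal ∧ M ≠ ⊥) N

/-- The socle of `G`: the subgroup generated by the minimal normal subgroups of `G`. -/
def socle (G : Type*) [Group G] : Subgroup G :=
  sSup {N : Subgroup G | IsMinimalNormal N}

/-- The socle of a permutation group `G ≤ Sym(Ω)`, as a permutation group on `Ω`. -/
def permSocle {Ω : Type*} (G : Subgroup (Equiv.Perm Ω)) : Subgroup (Equiv.Perm Ω) :=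
  (socle G).map G.subtype

/-- `Δ(G)`: the set of derangements (permutations without fixed points) in `G ≤ Sym(Ω)`. -/
def derangementSet {Ω : Type*} (G : Subgroup (Equiv.Perm Ω)) : Set (Equiv.Perm Ω) :=
  {g | g ∈ G ∧ ∀ x : Ω, g x ≠ x}

/-- The Larsen–Shalev–Tiep conjecture: `T = Δ(T)²` for every transitive permutation group `T`, on a
finite set `Γ`, that is a non-abelian simple group. (Every finite permutation group is
permutation isomorphic to one on a set in the lowest universe.) -/
def LarsenShalevTiepConjecture : Prop :=
  ∀ (Γ : Type) [Finite Γ] (T : Subgroup (Equiv.Perm Γ)),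
    IsSimpleGroup T → (∃ a b : T, a * b ≠ b * a) → MulAction.IsPretransitive T Γ →
      (T : Set (Equiv.Perm Γ)) = derangementSet T * derangementSet T

open scoped commutatorElement

/-! The socle N is transitive, so its derangements are the elements avoiding all conjugates of a
point stabiliser H, a proper subgroup. If some minimal normal subgroup is abelian, it equals N and
acts regularly; as there are at least three points, n = a · (a⁻¹n) with a different from 1 and n.

Otherwise N is perfect and its maximal normal subgroups meet trivially, and
`exists_mul_avoidsConjugates` distinguishes three cases. If HK ≠ N for some maximal normal K, the
conjecture applied to the simple group N/K lifts. If instead H(K ∩ L) ≠ N for two of them, H induces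
the graph of an isomorphism N/K ≅ N/L; elements in exactly one of K, L then avoid H, and products of
two such elements fill N without the conjecture. If neither happens, commutators in the perfect
group N force H = N (`eq_top_of_forall_sup_inf_eq_top`), a contradiction. -/

/-- `K` is maximal among the proper normal subgroups of `P`. -/
def IsMaximalNormal {P : Type*} [Group P] (K : Subgroup P) : Prop :=
  Maximal (fun M : Subgroup P => M.Normal ∧ M ≠ ⊤) K

/-- `a` lies in no conjugate of `H`, i.e. `a` acts on `P ⧸ H` without fixed points. -/
def AvoidsConjugates {P : Type*} [Group P] (H : Subgroup P) (a : P) : Prop :=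
  ∀ g : P, g⁻¹ * a * g ∉ H

theorem AvoidsConjugates.mono {P : Type*} [Group P] {H D : Subgroup P} (h : H ≤ D) {a : P}
    (ha : AvoidsConjugates D a) : AvoidsConjugates H a :=
  fun g hg => ha g (h hg)

/-! ### Lifting the conjecture from a simple quotient -/

/-- The conjugate-avoidance form of the Larsen–Shalev–Tiep conjecture, in any universe. -/
theorem LarsenShalevTiepConjecture.exists_mul_avoidsConjugates
    (hLST : LarsenShalevTiepConjecture) {Q : Type*} [Group Q] [Finite Q] [IsSimpleGroup Q]
    (hQ : ∃ a b : Q, a * b ≠ b * a) {R : Subgroup Q} (hR : R ≠ ⊤) (q : Q) :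
    ∃ a b : Q, q = a * b ∧ AvoidsConjugates R a ∧ AvoidsConjugates R b := by
  obtain ⟨n, ⟨e⟩⟩ := Finite.exists_equiv_fin (Q ⧸ R)
  let f : Q →* Equiv.Perm (Fin n) :=
    e.permCongrHom.toMonoidHom.comp (MulAction.toPermHom Q (Q ⧸ R))
  have hf : ∀ (a : Q) (x : Q ⧸ R), f a (e x) = e (a • x) := by
    intro a x
    simp [f, Equiv.permCongrHom]
  have hinj : Function.Injective f := by
    rw [← MonoidHom.ker_eq_bot_iff]
    -- A trivial action on cosets would give `R = ⊤`. So properness of `R` is what this step needs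
    -- and what the caller supplies; the stated `R ≠ ⊥` does not match, and the conclusion fails for
    -- `R = ⊤`.
    refine (f.normal_ker.eq_bot_or_eq_top).resolve_right fun h => hR ?_
    rw [eq_top_iff]
    intro a _
    have ha : a ∈ f.ker := h ▸ Subgroup.mem_top a
    have h1 := hf a ((1 : Q) : Q ⧸ R)
    rw [MonoidHom.mem_ker.1 ha, Equiv.Perm.one_apply] at h1
    have h2 := e.injective h1
    rw [MulAction.Quotient.smul_coe, QuotientGroup.eq] at h2
    simpa using h2
  let E : Q ≃* f.range := MonoidHom.ofInjective hinj
  have hsimple : IsSimpleGroup f.range := E.symm.isSimpleGroup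
  have hnc : ∃ a b : f.range, a * b ≠ b * a := by
    obtain ⟨a, b, hab⟩ := hQ
    exact ⟨E a, E b, fun h => hab (E.injective (by simpa using h))⟩
  have htrans : MulAction.IsPretransitive f.range (Fin n) := by
    refine ⟨fun x y => ?_⟩
    obtain ⟨g, hg⟩ := MulAction.exists_smul_eq Q (e.symm x) (e.symm y)
    refine ⟨⟨f g, g, rfl⟩, ?_⟩
    have := hf g (e.symm x)
    rw [hg] at this
    change f g x = y
    simpa using this
  have hav : ∀ a : Q, f a ∈ derangementSet f.range → AvoidsConjugates R a := by
    intro a ha g hg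
    refine ha.2 (e (g : Q ⧸ R)) ?_
    rw [hf, MulAction.Quotient.smul_coe]
    congr 1
    rw [eq_comm, QuotientGroup.eq]
    simpa [mul_assoc] using hg
  have hmem : f q ∈ (f.range : Set (Equiv.Perm (Fin n))) := ⟨q, rfl⟩
  rw [hLST (Fin n) f.range hsimple hnc htrans] at hmem
  obtain ⟨x, hx, y, hy, hxy⟩ := Set.mem_mul.1 hmem
  obtain ⟨a, rfl⟩ := hx.1
  obtain ⟨b, rfl⟩ := hy.1
  exact ⟨a, b, hinj (by simpa using hxy.symm), hav a hx, hav b hy⟩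

theorem IsMaximalNormal.isSimpleGroup_quotient {P : Type*} [Group P] {K : Subgroup P} [K.Normal]
    (hK : IsMaximalNormal K) : IsSimpleGroup (P ⧸ K) where
  exists_pair_ne := by
    have : Nontrivial (P ⧸ K) := QuotientGroup.nontrivial_iff.2 hK.prop.2
    exact exists_pair_ne _
  eq_bot_or_eq_top_of_normal := by
    intro M hM
    have hle : K ≤ M.comap (QuotientGroup.mk' K) := by
      conv_lhs => rw [← QuotientGroup.ker_mk' K]
      exact Subgroup.ker_le_comap _ _
    have hsurj := QuotientGroup.mk'_surjective K
    by_cases h : M.comap (QuotientGroup.mk' K) = ⊤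
    · right
      rw [← Subgroup.map_comap_eq_self_of_surjective hsurj M, h,
        Subgroup.map_top_of_surjective _ hsurj]
    · left
      have := hK.eq_of_le ⟨hM.comap _, h⟩ hle
      rw [← Subgroup.map_comap_eq_self_of_surjective hsurj M, ← this,
        QuotientGroup.map_mk'_self]

theorem IsMaximalNormal.sup_eq_top {P : Type*} [Group P] {K M : Subgroup P}
    (hK : IsMaximalNormal K) [M.Normal] (h : ¬ M ≤ K) : K ⊔ M = ⊤ := by
  have := hK.prop.1
  by_contra hne
  exact h (le_sup_right.trans (hK.eq_of_le ⟨inferInstance, hne⟩ le_sup_left).ge)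

theorem exists_commutatorElement_notMem {P : Type*} [Group P] (hP : commutator P = ⊤)
    {K : Subgroup P} (hK : K ≠ ⊤) : ∃ p q : P, ⁅p, q⁆ ∉ K := by
  by_contra! h
  refine hK (eq_top_iff.2 ?_)
  rw [← hP, commutator_def, Subgroup.commutator_le]
  exact fun p _ q _ => h p q

theorem exists_mul_avoidsConjugates_of_sup_ne_top (hLST : LarsenShalevTiepConjecture)
    {P : Type*} [Group P] [Finite P] (hP : commutator P = ⊤) {H K : Subgroup P}
    (hK : IsMaximalNormal K) (hHK : H ⊔ K ≠ ⊤) (n : P) :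
    ∃ a b : P, n = a * b ∧ AvoidsConjugates H a ∧ AvoidsConjugates H b := by
  have := hK.prop.1
  have := hK.isSimpleGroup_quotient
  have hnc : ∃ a b : P ⧸ K, a * b ≠ b * a := by
    obtain ⟨p, q, hpq⟩ := exists_commutatorElement_notMem hP hK.prop.2
    refine ⟨p, q, fun h => hpq ?_⟩
    rw [← commutatorElement_eq_one_iff_mul_comm] at h
    exact (QuotientGroup.eq_one_iff _).1 h
  have hR : H.map (QuotientGroup.mk' K) ≠ ⊤ := by
    intro h
    have := Subgroup.comap_map_eq (QuotientGroup.mk' K) H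
    rw [h, QuotientGroup.ker_mk', Subgroup.comap_top] at this
    exact hHK this.symm
  have lift : ∀ a : P, AvoidsConjugates (H.map (QuotientGroup.mk' K)) (a : P ⧸ K) →
      AvoidsConjugates H a := fun a ha g hg => ha g ⟨_, hg, rfl⟩
  obtain ⟨a, b, hab, ha, hb⟩ := hLST.exists_mul_avoidsConjugates hnc hR (n : P ⧸ K)
  obtain ⟨a, rfl⟩ := QuotientGroup.mk_surjective a
  refine ⟨a, a⁻¹ * n, by group, lift _ ha, lift _ ?_⟩
  have : ((a⁻¹ * n : P) : P ⧸ K) = b := by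
    rw [QuotientGroup.mk_mul, hab, QuotientGroup.mk_inv, inv_mul_cancel_left]
  rwa [this]

/-! ### Diagonal subgroups of two simple quotients -/

/-- A proper subgroup supplementing two maximal normal subgroups and containing their intersection
is, modulo that intersection, the graph of an isomorphism. -/
theorem inf_le_of_sup_eq_top {P : Type*} [Group P] {D K L : Subgroup P} (hK : IsMaximalNormal K)
    (hL : IsMaximalNormal L) (hD : D ≠ ⊤) (hKL : K ⊓ L ≤ D) (hDK : D ⊔ K = ⊤) (hDL : D ⊔ L = ⊤) :
    D ⊓ K ≤ L := by
  have := hK.prop.1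
  have := hL.prop.1
  by_contra hnot
  -- D normalises D ∩ K, and L centralises it modulo K ∩ L ≤ D; together they generate P.
  have hnorm : (D ⊓ K).Normal := by
    refine ⟨fun x hx g => ?_⟩
    obtain ⟨d, hd, l, hl, rfl⟩ :=
      Subgroup.mem_sup_of_normal_right.1 (hDL ▸ Subgroup.mem_top g : g ∈ D ⊔ L)
    have h1 : l * x * l⁻¹ ∈ D ⊓ K := by
      have h2 : ⁅l, x⁆ ∈ K ⊓ L :=
        inf_comm L K ▸ Subgroup.commutator_le_inf L K (Subgroup.commutator_mem_commutator hl hx.2)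
      have h3 : l * x * l⁻¹ = ⁅l, x⁆ * x := by simp [commutatorElement_def]
      rw [h3]
      exact mul_mem ⟨hKL h2, h2.1⟩ hx
    have h4 : d * l * x * (d * l)⁻¹ = d * (l * x * l⁻¹) * d⁻¹ := by group
    rw [h4]
    exact ⟨D.mul_mem (D.mul_mem hd h1.1) (D.inv_mem hd), hK.prop.1.conj_mem _ h1.2 d⟩
  have htop := hL.sup_eq_top hnot
  -- Dedekind's law: K = (K ∩ L)(D ∩ K).
  have hKD : K ≤ D := by
    intro k hk
    obtain ⟨l, hl, x, hx, rfl⟩ :=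
      Subgroup.mem_sup_of_normal_right.1 (htop ▸ Subgroup.mem_top k : k ∈ L ⊔ D ⊓ K)
    refine mul_mem (hKL ⟨?_, hl⟩) hx.1
    simpa using mul_mem hk (K.inv_mem hx.2)
  exact hD (by rw [← hDK, sup_eq_left.2 hKD])

/-- P/L is non-abelian, so it has an element other than 1 and the image of n; K maps onto P/L, so a
preimage can be taken in K. -/
theorem exists_mul_of_mem_left {P : Type*} [Group P] (hP : commutator P = ⊤)
    {K L : Subgroup P} (hK : IsMaximalNormal K) (hL : IsMaximalNormal L) (hne : K ≠ L)
    {n : P} (hn : n ∈ K) :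
    ∃ a b : P, n = a * b ∧ (a ∈ K ∧ a ∉ L) ∧ (b ∈ K ∧ b ∉ L) := by
  have := hK.prop.1
  have := hL.prop.1
  have htop : K ⊔ L = ⊤ := by
    rw [sup_comm]
    exact hL.sup_eq_top fun h => hne (hK.eq_of_le hL.prop h)
  obtain ⟨p, hpL, hpn⟩ : ∃ p : P, p ∉ L ∧ p⁻¹ * n ∉ L := by
    obtain ⟨p, q, hpq⟩ := exists_commutatorElement_notMem hP hL.prop.2
    rw [← QuotientGroup.eq_one_iff] at hpq
    change ⁅(p : P ⧸ L), (q : P ⧸ L)⁆ ≠ 1 at hpq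
    by_contra! h
    simp only [← QuotientGroup.eq_one_iff (N := L), QuotientGroup.mk_mul, QuotientGroup.mk_inv,
      inv_mul_eq_one] at h
    have hp : (p : P ⧸ L) ≠ 1 := fun h1 => hpq (by rw [h1, commutatorElement_one_left])
    have hq : (q : P ⧸ L) ≠ 1 := fun h1 => hpq (by rw [h1, commutatorElement_one_right])
    exact hpq (by rw [h p hp, h q hq, commutatorElement_self])
  obtain ⟨k, hk, l, hl, rfl⟩ :=
    Subgroup.mem_sup_of_normal_right.1 (htop ▸ Subgroup.mem_top p : p ∈ K ⊔ L)
  refine ⟨k, k⁻¹ * n, by group, ⟨hk, fun h => hpL (mul_mem h hl)⟩,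
    ⟨mul_mem (inv_mem hk) hn, fun h => hpn ?_⟩⟩
  have : (k * l)⁻¹ * n = l⁻¹ * (k⁻¹ * n) := by group
  rw [this]
  exact mul_mem (inv_mem hl) h

theorem exists_mul_mem_iff_notMem {P : Type*} [Group P] (hP : commutator P = ⊤)
    {K L : Subgroup P} (hK : IsMaximalNormal K) (hL : IsMaximalNormal L) (hne : K ≠ L) (n : P) :
    ∃ a b : P, n = a * b ∧ ¬ (a ∈ K ↔ a ∈ L) ∧ ¬ (b ∈ K ↔ b ∈ L) := by
  by_cases hnK : n ∈ K
  · obtain ⟨a, b, h, ha, hb⟩ := exists_mul_of_mem_left hP hK hL hne hnK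
    exact ⟨a, b, h, by tauto, by tauto⟩
  by_cases hnL : n ∈ L
  · obtain ⟨a, b, h, ha, hb⟩ := exists_mul_of_mem_left hP hL hK hne.symm hnL
    exact ⟨a, b, h, by tauto, by tauto⟩
  have := hK.prop.1
  have := hL.prop.1
  have htop : K ⊔ L = ⊤ := by
    rw [sup_comm]
    exact hL.sup_eq_top fun h => hne (hK.eq_of_le hL.prop h)
  obtain ⟨k, hk, l, hl, rfl⟩ :=
    Subgroup.mem_sup_of_normal_right.1 (htop ▸ Subgroup.mem_top n : n ∈ K ⊔ L)
  have h1 : k ∉ L := fun h => hnL (mul_mem h hl)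
  have h2 : l ∉ K := fun h => hnK (mul_mem hk h)
  exact ⟨k, l, rfl, by tauto, by tauto⟩

theorem exists_mul_avoidsConjugates_of_sup_inf_ne_top {P : Type*} [Group P]
    (hP : commutator P = ⊤) {H K L : Subgroup P} (hK : IsMaximalNormal K)
    (hL : IsMaximalNormal L) (hne : K ≠ L) (hHK : H ⊔ K = ⊤) (hHL : H ⊔ L = ⊤)
    (hH : H ⊔ (K ⊓ L) ≠ ⊤) (n : P) :
    ∃ a b : P, n = a * b ∧ AvoidsConjugates H a ∧ AvoidsConjugates H b := by
  have hDK : H ⊔ (K ⊓ L) ⊔ K = ⊤ := top_unique (hHK ▸ sup_le_sup_right le_sup_left K)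
  have hDL : H ⊔ (K ⊓ L) ⊔ L = ⊤ := top_unique (hHL ▸ sup_le_sup_right le_sup_left L)
  have h1 := inf_le_of_sup_eq_top hK hL hH le_sup_right hDK hDL
  have h2 := inf_le_of_sup_eq_top hL hK hH (inf_comm K L ▸ le_sup_right) hDL hDK
  have key : ∀ a : P, ¬ (a ∈ K ↔ a ∈ L) → AvoidsConjugates H a := by
    intro a ha
    refine AvoidsConjugates.mono (le_sup_left : H ≤ H ⊔ (K ⊓ L)) fun g hg => ha ?_
    have e : ∀ M : Subgroup P, M.Normal → (g⁻¹ * a * g ∈ M ↔ a ∈ M) := by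
      intro M hM
      rw [hM.mem_comm_iff, mul_inv_cancel_left]
    rw [← e K hK.prop.1, ← e L hL.prop.1]
    exact ⟨fun h => h1 ⟨hg, h⟩, fun h => h2 ⟨hg, h⟩⟩
  obtain ⟨a, b, h, ha, hb⟩ := exists_mul_mem_iff_notMem hP hK hL hne n
  exact ⟨a, b, h, key a ha, key b hb⟩

/-! ### Supplements of intersections of maximal normal subgroups -/

theorem Subgroup.normal_finset_inf {P : Type*} [Group P] {S : Finset (Subgroup P)}
    (hS : ∀ K ∈ S, K.Normal) : (S.inf id).Normal :=
  Finset.inf_induction (p := Subgroup.Normal) inferInstance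
    (fun _ _ _ _ => inferInstance) hS

/-- In a perfect group, if the intersections of `H` with normal subgroups `M` and `K` both supplement
`L`, then so does the intersection of `H` with `K ⊓ M`. -/
theorem inf_inf_sup_eq_top {P : Type*} [Group P] (hP : commutator P = ⊤) {H M K L : Subgroup P}
    [M.Normal] [K.Normal] [L.Normal] (hM : (H ⊓ M) ⊔ L = ⊤) (hK : (H ⊓ K) ⊔ L = ⊤) :
    (H ⊓ (K ⊓ M)) ⊔ L = ⊤ := by
  have hsurj := QuotientGroup.mk'_surjective L
  have e : ∀ A : Subgroup P, A ⊔ L = ⊤ ↔ A.map (QuotientGroup.mk' L) = ⊤ := by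
    intro A
    have h := Subgroup.comap_map_eq (QuotientGroup.mk' L) A
    rw [QuotientGroup.ker_mk'] at h
    rw [← h]
    constructor
    · intro h
      rw [← Subgroup.map_comap_eq_self_of_surjective hsurj (A.map _), h,
        Subgroup.map_top_of_surjective _ hsurj]
    · intro h
      rw [h, Subgroup.comap_top]
  rw [e] at hM hK ⊢
  -- Modulo L both entries become the whole perfect quotient, hence so does their commutator.
  have hle : ⁅H ⊓ M, H ⊓ K⁆ ≤ H ⊓ (K ⊓ M) := by
    refine le_inf ?_ (le_inf ?_ ?_)
    · rw [Subgroup.commutator_le]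
      intro a ha b hb
      exact mul_mem (mul_mem (mul_mem ha.1 hb.1) (inv_mem ha.1)) (inv_mem hb.1)
    · exact (Subgroup.commutator_mono le_top inf_le_right).trans (Subgroup.commutator_le_right ⊤ K)
    · exact (Subgroup.commutator_mono inf_le_right le_top).trans (Subgroup.commutator_le_left M ⊤)
  refine top_unique ((Subgroup.map_mono hle).trans' ?_)
  rw [Subgroup.map_commutator, hM, hK, ← Subgroup.map_top_of_surjective _ hsurj,
    ← Subgroup.map_commutator, ← commutator_def, hP]

theorem inf_finset_inf_sup_eq_top {P : Type*} [Group P] (hP : commutator P = ⊤) {H : Subgroup P}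
    (hH : ∀ K L : Subgroup P, IsMaximalNormal K → IsMaximalNormal L → H ⊔ (K ⊓ L) = ⊤)
    {L : Subgroup P} (hL : IsMaximalNormal L) (S : Finset (Subgroup P))
    (hS : ∀ K ∈ S, IsMaximalNormal K) (hLS : L ∉ S) : (H ⊓ S.inf id) ⊔ L = ⊤ := by
  classical
  have := hL.prop.1
  induction S using Finset.induction_on with
  | empty => simpa using hH L L hL hL
  | insert K S hKS ih =>
    have hKm := hS K (Finset.mem_insert_self _ _)
    have hSm : ∀ M ∈ S, IsMaximalNormal M := fun M hM => hS M (Finset.mem_insert_of_mem hM)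
    have := hKm.prop.1
    have : (S.inf id).Normal := Subgroup.normal_finset_inf fun M hM => (hSm M hM).prop.1
    rw [Finset.inf_insert, id_eq]
    refine inf_inf_sup_eq_top hP (ih hSm fun h => hLS (Finset.mem_insert_of_mem h)) ?_
    have hne : K ≠ L := fun h => hLS (h ▸ Finset.mem_insert_self _ _)
    have htop : K ⊔ L = ⊤ := by
      rw [sup_comm]
      exact hL.sup_eq_top fun h => hne (hKm.eq_of_le hL.prop h)
    refine top_unique fun p _ => ?_
    obtain ⟨k, hk, l, hl, rfl⟩ :=
      Subgroup.mem_sup_of_normal_right.1 (htop ▸ Subgroup.mem_top p : p ∈ K ⊔ L)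
    obtain ⟨h, hh, m, hm, rfl⟩ := Subgroup.mem_sup_of_normal_right.1
      (hH K L hKm hL ▸ Subgroup.mem_top k : k ∈ H ⊔ (K ⊓ L))
    refine Subgroup.mem_sup_of_normal_right.2 ⟨h, ⟨hh, ?_⟩, m * l, mul_mem hm.2 hl, by group⟩
    simpa using mul_mem hk (K.inv_mem hm.1)

/-- In a perfect finite group whose maximal normal subgroups intersect trivially, a subgroup
supplementing all pairwise intersections of maximal normal subgroups is the whole group. -/
theorem eq_top_of_forall_sup_inf_eq_top {P : Type*} [Group P] [Finite P]
    (hP : commutator P = ⊤) (hbot : sInf {K : Subgroup P | IsMaximalNormal K} = ⊥) {H : Subgroup P}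
    (hH : ∀ K L : Subgroup P, IsMaximalNormal K → IsMaximalNormal L → H ⊔ (K ⊓ L) = ⊤) :
    H = ⊤ := by
  classical
  have key : ∀ S : Finset (Subgroup P), (∀ K ∈ S, IsMaximalNormal K) → H ⊔ S.inf id = ⊤ := by
    intro S hS
    induction S using Finset.induction_on with
    | empty => simp
    | insert K S hKS ih =>
      have hKm := hS K (Finset.mem_insert_self _ _)
      have hSm : ∀ M ∈ S, IsMaximalNormal M := fun M hM => hS M (Finset.mem_insert_of_mem hM)
      have := hKm.prop.1
      have : (S.inf id).Normal := Subgroup.normal_finset_inf fun M hM => (hSm M hM).prop.1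
      have htop := inf_finset_inf_sup_eq_top hP hH hKm S hSm hKS
      rw [Finset.inf_insert, id_eq]
      refine top_unique fun p _ => ?_
      obtain ⟨h, hh, m, hm, rfl⟩ := Subgroup.mem_sup_of_normal_right.1
        (ih hSm ▸ Subgroup.mem_top p : p ∈ H ⊔ S.inf id)
      -- Correcting m by an element of H ∩ ⋂S leaves a remainder in K that is still in ⋂S.
      obtain ⟨h', hh', k, hk, rfl⟩ := Subgroup.mem_sup_of_normal_right.1
        (htop ▸ Subgroup.mem_top m : m ∈ (H ⊓ S.inf id) ⊔ K)
      refine Subgroup.mem_sup_of_normal_right.2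
        ⟨h * h', H.mul_mem hh hh'.1, k, ⟨hk, ?_⟩, by group⟩
      simpa using (S.inf id).mul_mem ((S.inf id).inv_mem hh'.2) hm
  have hfin : {K : Subgroup P | IsMaximalNormal K}.Finite := Set.toFinite _
  have h := key hfin.toFinset (fun K hK => hfin.mem_toFinset.1 hK)
  rwa [Finset.inf_id_eq_sInf, hfin.coe_toFinset, hbot, sup_bot_eq] at h

theorem exists_mul_avoidsConjugates (hLST : LarsenShalevTiepConjecture)
    {P : Type*} [Group P] [Finite P] (hP : commutator P = ⊤)
    (hbot : sInf {K : Subgroup P | IsMaximalNormal K} = ⊥) {H : Subgroup P} (hH : H ≠ ⊤) (n : P) :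
    ∃ a b : P, n = a * b ∧ AvoidsConjugates H a ∧ AvoidsConjugates H b := by
  by_cases h1 : ∃ K, IsMaximalNormal K ∧ H ⊔ K ≠ ⊤
  · obtain ⟨K, hK, hHK⟩ := h1
    exact exists_mul_avoidsConjugates_of_sup_ne_top hLST hP hK hHK n
  push Not at h1
  by_cases h2 : ∃ K L, IsMaximalNormal K ∧ IsMaximalNormal L ∧ H ⊔ (K ⊓ L) ≠ ⊤
  · obtain ⟨K, L, hK, hL, hHKL⟩ := h2
    have hne : K ≠ L := by
      rintro rfl
      exact hHKL (by rw [inf_idem, h1 K hK])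
    exact exists_mul_avoidsConjugates_of_sup_inf_ne_top hP hK hL hne (h1 K hK) (h1 L hL) hHKL n
  · push Not at h2
    exact absurd (eq_top_of_forall_sup_inf_eq_top hP hbot h2) hH

/-! ### Structure of the socle -/

theorem IsMinimalNormal.le_of_inf_ne_bot {G : Type*} [Group G] {M L : Subgroup G}
    (hM : IsMinimalNormal M) [L.Normal] (h : M ⊓ L ≠ ⊥) : M ≤ L := by
  have := hM.prop.1
  exact inf_eq_left.1 (hM.eq_of_ge ⟨inferInstance, h⟩ inf_le_left).symm

theorem exists_isMinimalNormal_le {G : Type*} [Group G] [Finite G] {L : Subgroup G} (hL : L.Normal)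
    (hne : L ≠ ⊥) : ∃ M ≤ L, IsMinimalNormal M :=
  exists_minimal_le_of_wellFoundedLT _ L ⟨hL, hne⟩

theorem IsMinimalNormal.le_socle {G : Type*} [Group G] {M : Subgroup G} (hM : IsMinimalNormal M) :
    M ≤ socle G :=
  le_sSup hM

theorem Subgroup.normal_sSup {G : Type*} [Group G] {S : Set (Subgroup G)}
    (hS : ∀ M ∈ S, M.Normal) : (sSup S).Normal := by
  refine ⟨fun n hn g => ?_⟩
  have : sSup S ≤ (sSup S).comap (MulAut.conj g).toMonoidHom := by
    refine sSup_le fun M hM x hx => ?_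
    exact le_sSup hM ((hS M hM).conj_mem x hx g)
  exact this hn

instance socle_normal (G : Type*) [Group G] : (socle G).Normal :=
  Subgroup.normal_sSup fun _ (hM : IsMinimalNormal _) => hM.prop.1

theorem commutator_socle_eq_top {G : Type*} [Group G]
    (hG : ∀ M : Subgroup G, IsMinimalNormal M → ⁅M, M⁆ ≠ ⊥) : commutator (socle G) = ⊤ := by
  have h : socle G ≤ ⁅socle G, socle G⁆ := by
    refine sSup_le fun M (hM : IsMinimalNormal M) => ?_
    have := hM.prop.1
    have h1 : M = ⁅M, M⁆ := hM.eq_of_ge ⟨inferInstance, hG M hM⟩ (Subgroup.commutator_le_left M M)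
    rw [h1]
    exact Subgroup.commutator_mono hM.le_socle hM.le_socle
  refine Subgroup.map_injective (socle G).subtype_injective ?_
  rw [Subgroup.map_subtype_commutator, ← MonoidHom.range_eq_map, Subgroup.range_subtype]
  exact le_antisymm (Subgroup.commutator_le_self _) h

theorem IsMaximalNormal.comap {P : Type*} [Group P] {K : Subgroup P} (hK : IsMaximalNormal K)
    (φ : P ≃* P) : IsMaximalNormal (K.comap φ.toMonoidHom) := by
  have hφ : Function.Surjective φ.toMonoidHom := φ.surjective
  refine ⟨⟨hK.prop.1.comap _, fun h => hK.prop.2 ?_⟩, fun L hL hKL => ?_⟩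
  · rw [← Subgroup.map_comap_eq_self_of_surjective hφ K, h, Subgroup.map_top_of_surjective _ hφ]
  · rw [← Subgroup.map_le_iff_le_comap]
    refine hK.le_of_ge ⟨hL.1.map _ hφ, fun h => hL.2 ?_⟩ ?_
    · rw [← Subgroup.comap_map_eq_self_of_injective (f := φ.toMonoidHom) φ.injective L, h,
        Subgroup.comap_top]
    · rw [← Subgroup.map_comap_eq_self_of_surjective hφ K]
      exact Subgroup.map_mono hKL

instance characteristic_sInf_isMaximalNormal (P : Type*) [Group P] :
    (sInf {K : Subgroup P | IsMaximalNormal K}).Characteristic := by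
  rw [Subgroup.characteristic_iff_le_comap]
  intro φ x hx
  rw [Subgroup.mem_comap, Subgroup.mem_sInf]
  intro K hK
  exact Subgroup.mem_sInf.1 hx _ (IsMaximalNormal.comap hK φ)

/-- A minimal normal subgroup has a normal complement in the socle. -/
theorem IsMinimalNormal.exists_isCompl_socle {G : Type*} [Group G] [Finite G] {M : Subgroup G}
    (hM : IsMinimalNormal M) :
    ∃ L : Subgroup G, L.Normal ∧ M ⊓ L = ⊥ ∧ socle G ≤ M ⊔ L := by
  have := hM.prop.1
  obtain ⟨L, hL⟩ := (Set.toFinite {L : Subgroup G | L.Normal ∧ M ⊓ L = ⊥}).exists_maximal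
    ⟨⊥, inferInstance, inf_bot_eq _⟩
  have := hL.prop.1
  refine ⟨L, hL.prop.1, hL.prop.2, sSup_le fun S (hS : IsMinimalNormal S) => ?_⟩
  by_contra hnot
  have := hS.prop.1
  have hbot : S ⊓ (M ⊔ L) = ⊥ := by
    by_contra h
    exact hnot (IsMinimalNormal.le_of_inf_ne_bot hS h)
  refine hnot ((hL.le_of_ge (y := L ⊔ S) ⟨inferInstance, ?_⟩ le_sup_left).trans' le_sup_right
    |>.trans le_sup_right)
  rw [eq_bot_iff]
  rintro x ⟨hxM, hx⟩
  obtain ⟨l, hl, s, hs, rfl⟩ := Subgroup.mem_sup_of_normal_right.1 hx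
  have hs' : s ∈ S ⊓ (M ⊔ L) := by
    refine ⟨hs, ?_⟩
    have := mul_mem (inv_mem (Subgroup.mem_sup_right hl : l ∈ M ⊔ L)) (Subgroup.mem_sup_left hxM)
    simpa using this
  rw [hbot, Subgroup.mem_bot] at hs'
  rw [hs', mul_one] at hxM ⊢
  exact hL.prop.2 ▸ (⟨hxM, hl⟩ : l ∈ M ⊓ L)

/-- If a minimal normal M lay in the intersection, a maximal normal subgroup containing a complement
of M would also contain M, hence everything. -/
theorem sInf_isMaximalNormal_socle {G : Type*} [Group G] [Finite G] :
    sInf {K : Subgroup (socle G) | IsMaximalNormal K} = ⊥ := by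
  by_contra hne
  set X := sInf {K : Subgroup (socle G) | IsMaximalNormal K} with hX
  have hXne : X.map (socle G).subtype ≠ ⊥ := by
    rwa [Ne, Subgroup.map_eq_bot_iff_of_injective _ (socle G).subtype_injective]
  obtain ⟨M, hMX, hM⟩ := exists_isMinimalNormal_le (L := X.map (socle G).subtype)
    inferInstance hXne
  obtain ⟨L, hLn, hLM, htop⟩ := hM.exists_isCompl_socle
  have := hM.prop.1
  have hproper : L.subgroupOf (socle G) ≠ ⊤ := by
    rw [Ne, Subgroup.subgroupOf_eq_top]
    intro h
    exact hM.prop.2 (by rw [← hLM, inf_eq_left.2 (hM.le_socle.trans h)])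
  obtain ⟨K, hLK, hK⟩ := exists_maximal_ge_of_wellFoundedGT
    (fun K : Subgroup (socle G) => K.Normal ∧ K ≠ ⊤) (L.subgroupOf (socle G))
    ⟨inferInstance, hproper⟩
  refine hK.prop.2 (top_unique fun n _ => ?_)
  obtain ⟨m, hm, l, hl, hml⟩ := Subgroup.mem_sup_of_normal_right.1 (htop n.2)
  obtain ⟨m', hm', rfl⟩ := hMX hm
  have hl' : (m'⁻¹ * n) ∈ K := by
    apply hLK
    rw [Subgroup.mem_subgroupOf]
    simpa [← hml] using hl
  have hmK : m' ∈ K := Subgroup.mem_sInf.1 (hX ▸ hm') K hK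
  simpa using mul_mem hmK hl'

/-! ### Primitive groups and derangements -/

theorem isPretransitive_of_normal_ne_bot {Ω : Type*} {G : Subgroup (Equiv.Perm Ω)}
    (hG : MulAction.IsPreprimitive G Ω) {M : Subgroup G} [M.Normal] (hM : M ≠ ⊥) :
    MulAction.IsPretransitive M Ω := by
  refine MulAction.IsQuasiPreprimitive.isPretransitive_of_normal fun h => hM ?_
  rw [eq_bot_iff]
  intro m hm
  rw [Subgroup.mem_bot]
  ext x
  exact (h ▸ Set.mem_univ x : x ∈ MulAction.fixedPoints M Ω) ⟨m, hm⟩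

/-- c agrees with some m ∈ M at one point; commuting with the transitive M spreads the agreement to
all points. -/
theorem mem_of_forall_commute_of_isPretransitive {G Ω : Type*} [Group G] [MulAction G Ω]
    [FaithfulSMul G Ω] [Nonempty Ω] {M : Subgroup G} [MulAction.IsPretransitive M Ω]
    (hM : ∀ a ∈ M, ∀ b ∈ M, a * b = b * a) {c : G} (hc : ∀ a ∈ M, a * c = c * a) : c ∈ M := by
  obtain ⟨x⟩ := ‹Nonempty Ω›
  obtain ⟨⟨m, hm⟩, hmx⟩ := MulAction.exists_smul_eq M x (c • x)
  change m • x = c • x at hmx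
  suffices c = m from this ▸ hm
  refine FaithfulSMul.eq_of_smul_eq_smul (α := Ω) fun y => ?_
  obtain ⟨⟨a, ha⟩, rfl⟩ := MulAction.exists_smul_eq M x y
  change c • a • x = m • a • x
  rw [← mul_smul, ← mul_smul, ← hc a ha, hM m hm a ha, mul_smul, mul_smul, hmx]

/-- An abelian minimal normal subgroup of a primitive group is its socle. -/
theorem IsMinimalNormal.socle_le_of_commutator_eq_bot {Ω : Type*} [Nonempty Ω]
    {G : Subgroup (Equiv.Perm Ω)} (hG : MulAction.IsPreprimitive G Ω) {M : Subgroup G}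
    (hM : IsMinimalNormal M) (hab : ⁅M, M⁆ = ⊥) : socle G ≤ M := by
  have := hM.prop.1
  have := isPretransitive_of_normal_ne_bot hG hM.prop.2
  have hcomm : ∀ a ∈ M, ∀ b ∈ M, a * b = b * a := by
    intro a ha b hb
    rw [← commutatorElement_eq_one_iff_mul_comm, ← Subgroup.mem_bot, ← hab]
    exact Subgroup.commutator_mem_commutator ha hb
  refine sSup_le fun S (hS : IsMinimalNormal S) => ?_
  have := hS.prop.1
  by_cases h : S ⊓ M = ⊥
  · intro c hc
    refine mem_of_forall_commute_of_isPretransitive (Ω := Ω) hcomm fun a ha => ?_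
    exact (Subgroup.commute_of_normal_of_disjoint S M hS.prop.1 hM.prop.1
      (disjoint_iff.2 h) c a hc ha).symm
  · exact IsMinimalNormal.le_of_inf_ne_bot hS h

/-- In a transitive abelian group, non-identity elements are derangements. -/
theorem eq_one_of_smul_eq_of_isPretransitive {G Ω : Type*} [Group G] [MulAction G Ω]
    [FaithfulSMul G Ω] {M : Subgroup G} [MulAction.IsPretransitive M Ω]
    (hM : ∀ a ∈ M, ∀ b ∈ M, a * b = b * a) {c : G} (hc : c ∈ M) {x : Ω} (hx : c • x = x) :
    c = 1 := by
  refine FaithfulSMul.eq_of_smul_eq_smul (α := Ω) fun y => ?_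
  obtain ⟨⟨a, ha⟩, rfl⟩ := MulAction.exists_smul_eq M x y
  change c • a • x = (1 : G) • a • x
  rw [one_smul, ← mul_smul, hM c hc a ha, mul_smul, hx]

/-- Every element of the socle of a primitive group is a product of two derangements. -/
theorem exists_mul_derangements_of_mem_socle {Ω : Type*} [Finite Ω] (hΩ : 3 ≤ Nat.card Ω)
    {G : Subgroup (Equiv.Perm Ω)} (hG : MulAction.IsPreprimitive G Ω)
    (hLST : LarsenShalevTiepConjecture) {n : G} (hn : n ∈ socle G) :
    ∃ a ∈ socle G, ∃ b ∈ socle G, n = a * b ∧ (∀ x : Ω, a • x ≠ x) ∧ ∀ x : Ω, b • x ≠ x := by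
  have hnt : Nontrivial Ω := Finite.one_lt_card_iff_nontrivial.1 (by omega)
  by_cases hab : ∃ M : Subgroup G, IsMinimalNormal M ∧ ⁅M, M⁆ = ⊥
  · obtain ⟨M, hM, hMab⟩ := hab
    have := hM.prop.1
    have := isPretransitive_of_normal_ne_bot hG hM.prop.2
    have hle := hM.socle_le_of_commutator_eq_bot hG hMab
    have hcomm : ∀ a ∈ M, ∀ b ∈ M, a * b = b * a := by
      intro a ha b hb
      rw [← commutatorElement_eq_one_iff_mul_comm, ← Subgroup.mem_bot, ← hMab]
      exact Subgroup.commutator_mem_commutator ha hb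
    obtain ⟨x⟩ : Nonempty Ω := inferInstance
    -- Sending x to a third point y makes both a and a⁻¹n nontrivial.
    obtain ⟨y, hy⟩ : ∃ y : Ω, y ∉ ({x, n • x} : Set Ω) := by
      by_contra! h
      have h1 : ({x, n • x} : Set Ω) = Set.univ := Set.eq_univ_of_forall h
      have h2 := Set.ncard_insert_le x {n • x}
      rw [Set.ncard_singleton] at h2
      rw [h1, Set.ncard_univ] at h2
      omega
    simp only [Set.mem_insert_iff, Set.mem_singleton_iff, not_or] at hy
    obtain ⟨⟨a, ha⟩, rfl⟩ := MulAction.exists_smul_eq M x y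
    change a • x ≠ x ∧ a • x ≠ n • x at hy
    refine ⟨a, hM.le_socle ha, a⁻¹ * n, mul_mem (inv_mem (hM.le_socle ha)) hn, by group,
      fun z hz => hy.1 ?_, fun z hz => hy.2 ?_⟩
    · rw [eq_one_of_smul_eq_of_isPretransitive hcomm ha hz, one_smul]
    · have := eq_one_of_smul_eq_of_isPretransitive hcomm (mul_mem (inv_mem ha) (hle hn)) hz
      rw [inv_mul_eq_one.1 this]
  · push Not at hab
    have hGne : Nontrivial G := by
      obtain ⟨x, y, hxy⟩ := exists_pair_ne Ω
      obtain ⟨g, rfl⟩ := MulAction.exists_smul_eq G x y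
      exact ⟨g, 1, fun h => hxy (by rw [h, one_smul])⟩
    obtain ⟨M, -, hM⟩ := exists_isMinimalNormal_le (G := G) (L := ⊤) inferInstance top_ne_bot
    have hne : socle G ≠ ⊥ := fun h => hM.prop.2 (le_bot_iff.1 (h ▸ hM.le_socle))
    have htrans := isPretransitive_of_normal_ne_bot hG hne
    obtain ⟨x, y, hxy⟩ := exists_pair_ne Ω
    have hH : MulAction.stabilizer (socle G) x ≠ ⊤ := by
      intro h
      obtain ⟨g, rfl⟩ := MulAction.exists_smul_eq (socle G) x y
      have hg : g ∈ MulAction.stabilizer (socle G) x := h ▸ Subgroup.mem_top g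
      exact hxy hg.symm
    obtain ⟨a, b, h, ha, hb⟩ := exists_mul_avoidsConjugates hLST (commutator_socle_eq_top hab)
      sInf_isMaximalNormal_socle hH ⟨n, hn⟩
    have key : ∀ a : socle G, AvoidsConjugates (MulAction.stabilizer (socle G) x) a →
        ∀ z : Ω, (a : G) • z ≠ z := by
      intro a ha z hz
      obtain ⟨g, rfl⟩ := MulAction.exists_smul_eq (socle G) x z
      refine ha g ?_
      change a • g • x = g • x at hz
      rw [MulAction.mem_stabilizer_iff, mul_smul, mul_smul, hz, inv_smul_smul]
    exact ⟨a, a.2, b, b.2, congrArg Subtype.val h, key a ha, key b hb⟩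

theorem theorem6 {Ω : Type*} [Finite Ω] (hΩ : 3 ≤ Nat.card Ω)
    (G : Subgroup (Equiv.Perm Ω)) (hG : MulAction.IsPreprimitive G Ω)
    (hLST : LarsenShalevTiepConjecture) :
    (permSocle G : Set (Equiv.Perm Ω)) =
      derangementSet (permSocle G) * derangementSet (permSocle G) := by
  refine Set.Subset.antisymm ?_ ?_
  · rintro _ ⟨n, hn, rfl⟩
    obtain ⟨a, ha, b, hb, rfl, hda, hdb⟩ := exists_mul_derangements_of_mem_socle hΩ hG hLST hn
    exact Set.mem_mul.2 ⟨a, ⟨⟨a, ha, rfl⟩, hda⟩, b, ⟨⟨b, hb, rfl⟩, hdb⟩, rfl⟩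
  · rintro _ ⟨a, ha, b, hb, rfl⟩
    exact mul_mem ha.1 hb.1
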